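/- Let $n$ qubits, with state space $\mathcal H=(\mathbb C^2)^{\otimes n}$, be placed on the vertices of a connectivity graph $\Lambda$ (the path graph for a one-dimensional array), and let $\mathcal P_n$ be the set of the $4^n$ $n$-qubit Pauli strings (tensor products of $\mathds 1,X,Y,Z$). Let $\mathcal S\subseteq\mathcal P_n$ and let $G\subseteq\mathbb U(\mathcal H)$ be a compact Pauli-compatible group with generators $\mathcal S$: the elements of $G$ are exactly the finite products $\prod_j e^{i\theta_jP_j}$ with $\theta_j\in\mathbb R$, $P_j\in\mathcal S$, and the space of operators commuting with $G$ is spanned by Pauli strings. Suppose that $G$ has an invariant state at $k=2$, that is, a unit vector $|\Psi\rangle\in\mathcal H^{\otimes 2}$ with $U^{\otimes2}|\Psi\rangle=|\Psi\rangle$ for all $U\in G$ (equivalently, there is a non-zero operator $\Omega$ on $\mathcal H$ with $P^{\mathsf T}\Omega+\Omega P=0$ for all $P\in\mathcal S$). Let $L\ge 0$ and let $\mathcal E_L$ be any ensemble (Borel probability measure) of elements of $G$ that are depth-$L$ 2-local circuits: products of $L$ layers, each layer a product of unitary gates acting on pairwise disjoint sets of qubits, each set being a single qubit or a pair of neighbours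 in $\Lambda$. Let $$\phi_L^{(2)}(X)=\mathbb E_{U\sim\mathcal E_L}\,U^{\otimes2}X(U^\dagger)^{\otimes2},\qquad \phi_G^{(2)}(X)=\mathbb E_{U\sim\mu_G}\,U^{\otimes2}X(U^\dagger)^{\otimes2},$$ with $\mu_G$ the Haar probability measure on $G$. Then for every Pauli string $P\in\mathcal P_n$ $$\|\phi_L^{(2)}-\phi_G^{(2)}\|_\diamond\;\ge\;2\bigl(1-r_G(P,L)\bigr),$$ where $\|\Phi\|_\diamond=\sup_\rho\|(\Phi\otimes\mathcal I_{\rm anc})\rho\|_1$, the supremum being over all density operators $\rho$ on the system with a finite-dimensional ancilla of any size. Here the commutator graph $\mathcal G_{\mathcal S}$ has vertex set $\mathcal P_n$ and an edge between $Q$ and $R$ iff $[H,Q]$ is a non-zero multiple of $R$ for some $H\in\mathcal S$, and $r_G(P,L)$ is the fraction of the Pauli strings in the connected component of $P$ in $\mathcal G_{\mathcal S}$ that act non-trivially only on qubits at distance at most $L$ in $\Lambda$ from the support of $P$ (the set of qubits on which $P$ acts non-trivially). -/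

import Mathlib

open scoped Kronecker Matrix ComplexOrder

/-! ### Qubits, unitaries and Pauli strings -/

/-- The label set of the computational basis of `n` qubits. -/
abbrev QBasis (n : ℕ) : Type := Fin n → Fin 2

/-- Linear operators on the `n`-qubit space `(ℂ²)^{⊗ n}`, in the computational basis. -/
abbrev QOp (n : ℕ) : Type := Matrix (QBasis n) (QBasis n) ℂ

/-- Linear operators on two copies of the `n`-qubit space. -/
abbrev QOp2 (n : ℕ) : Type := Matrix (QBasis n × QBasis n) (QBasis n × QBasis n) ℂ

/-- The group of unitaries on `n` qubits. -/
abbrev QUnitary (n : ℕ) : Type := Matrix.unitaryGroup (QBasis n) ℂ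

/-- The unitary group carries its Borel σ-algebra. -/
noncomputable instance instMeasurableSpaceQUnitary (n : ℕ) : MeasurableSpace (QUnitary n) := borel _

instance instBorelSpaceQUnitary (n : ℕ) : BorelSpace (QUnitary n) := ⟨rfl⟩

/-- The four single-qubit Pauli labels. -/
inductive Pauli : Type
  | I | X | Y | Z
  deriving DecidableEq

instance instFintypePauli : Fintype Pauli :=
  ⟨{.I, .X, .Y, .Z}, fun a => by cases a <;> decide⟩

/-- The single-qubit Pauli matrices. -/
noncomputable def Pauli.toMatrix : Pauli → Matrix (Fin 2) (Fin 2) ℂ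
  | .I => !![1, 0; 0, 1]
  | .X => !![0, 1; 1, 0]
  | .Y => !![0, -Complex.I; Complex.I, 0]
  | .Z => !![1, 0; 0, -1]

/-- `n`-qubit Pauli strings (there are `4 ^ n` of them, without phases). -/
abbrev PauliString (n : ℕ) : Type := Fin n → Pauli

/-- The tensor product of single-qubit operators. -/
noncomputable def tensorOp {n : ℕ} (A : Fin n → Matrix (Fin 2) (Fin 2) ℂ) : QOp n :=
  Matrix.of fun x y => ∏ i, A i (x i) (y i)

/-- The operator `P₁ ⊗ ⋯ ⊗ Pₙ` of a Pauli string. -/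
noncomputable def PauliString.op {n : ℕ} (P : PauliString n) : QOp n :=
  tensorOp fun i => (P i).toMatrix

/-- The qubits on which a Pauli string acts non-trivially. -/
def PauliString.support {n : ℕ} (P : PauliString n) : Set (Fin n) :=
  {i | P i ≠ Pauli.I}

/-! ### The commutator graph -/

/-- `[H, P] ∝ Q`, that is, the commutator is a non-zero multiple of `Q`. -/
def PauliString.CommutatorProp {n : ℕ} (H P Q : PauliString n) : Prop :=
  ∃ c : ℂ, c ≠ 0 ∧ H.op * P.op - P.op * H.op = c • Q.op

theorem tensorOp_mul {n : ℕ} (A B : Fin n → Matrix (Fin 2) (Fin 2) ℂ) :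
    tensorOp A * tensorOp B = tensorOp fun i => A i * B i := by
  ext x z
  simp only [tensorOp, Matrix.mul_apply, Matrix.of_apply, ← Finset.prod_mul_distrib]
  exact (Fintype.prod_sum fun (i : Fin n) (y : Fin 2) => A i (x i) y * B i y (z i)).symm

theorem tensorOp_one {n : ℕ} : tensorOp (fun _ : Fin n => (1 : Matrix (Fin 2) (Fin 2) ℂ)) = 1 := by
  ext x y
  simp only [tensorOp, Matrix.of_apply, Matrix.one_apply]
  by_cases h : x = y
  · simp [h]
  · obtain ⟨i, hi⟩ := Function.ne_iff.mp h
    rw [if_neg h]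
    exact Finset.prod_eq_zero (Finset.mem_univ i) (if_neg hi)

theorem tensorOp_smul {n : ℕ} (s : Fin n → ℂ) (A : Fin n → Matrix (Fin 2) (Fin 2) ℂ) :
    tensorOp (fun i => s i • A i) = (∏ i, s i) • tensorOp A := by
  ext x y
  simp [tensorOp, Finset.prod_mul_distrib]

theorem Pauli.toMatrix_mul_self (a : Pauli) : a.toMatrix * a.toMatrix = 1 := by
  cases a <;> ext i j <;> fin_cases i <;> fin_cases j <;> simp [Pauli.toMatrix, Matrix.mul_apply]

theorem Pauli.toMatrix_mul_comm (a b : Pauli) :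
    ∃ s : ℂ, (s = 1 ∨ s = -1) ∧ a.toMatrix * b.toMatrix = s • (b.toMatrix * a.toMatrix) := by
  by_cases h : a = b ∨ a = .I ∨ b = .I
  · refine ⟨1, Or.inl rfl, ?_⟩
    cases a <;> cases b <;> simp_all [Pauli.toMatrix]
  · refine ⟨-1, Or.inr rfl, ?_⟩
    cases a <;> cases b <;> simp_all [Pauli.toMatrix]

theorem PauliString.op_mul_self {n : ℕ} (P : PauliString n) : P.op * P.op = 1 := by
  simp only [PauliString.op, tensorOp_mul, Pauli.toMatrix_mul_self, tensorOp_one]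

theorem PauliString.op_ne_zero {n : ℕ} (P : PauliString n) : P.op ≠ 0 := by
  intro h
  have := P.op_mul_self
  rw [h, zero_mul] at this
  exact zero_ne_one this

theorem PauliString.op_mul_comm {n : ℕ} (P Q : PauliString n) :
    P.op * Q.op = Q.op * P.op ∨ P.op * Q.op = -(Q.op * P.op) := by
  choose s hs h using fun i => Pauli.toMatrix_mul_comm (P i) (Q i)
  have hp : (∏ i, s i) = 1 ∨ (∏ i, s i) = -1 := by
    refine Finset.prod_induction s (fun z => z = 1 ∨ z = -1) ?_ (Or.inl rfl) (fun i _ => hs i)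
    rintro a b (rfl | rfl) (rfl | rfl) <;> simp
  have hm : P.op * Q.op = (∏ i, s i) • (Q.op * P.op) := by
    simp only [PauliString.op, tensorOp_mul, h, tensorOp_smul]
  rcases hp with hp | hp
  · left; rw [hm, hp, one_smul]
  · right; rw [hm, hp, neg_one_smul]

/-- A non-zero commutator comes from anticommuting strings. -/
theorem PauliString.CommutatorProp.spec {n : ℕ} {H P Q : PauliString n}
    (h : H.CommutatorProp P Q) :
    H.op * P.op = -(P.op * H.op) ∧ ∃ c : ℂ, c ≠ 0 ∧ H.op * P.op = c • Q.op := by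
  obtain ⟨c, hc, h⟩ := h
  rcases H.op_mul_comm P with h1 | h1
  · rw [h1, sub_self] at h
    exact absurd h.symm (smul_ne_zero hc Q.op_ne_zero)
  · refine ⟨h1, c / 2, div_ne_zero hc two_ne_zero, ?_⟩
    have h2 : P.op * H.op = -(H.op * P.op) := by rw [h1, neg_neg]
    rw [h2, sub_neg_eq_add, ← two_smul ℂ] at h
    rw [div_eq_inv_mul, mul_smul, ← h, smul_smul, inv_mul_cancel₀ two_ne_zero, one_smul]

theorem PauliString.CommutatorProp.symm {n : ℕ} {H P Q : PauliString n}
    (h : H.CommutatorProp P Q) : H.CommutatorProp Q P := by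
  obtain ⟨ha, c, hc, h⟩ := h.spec
  have hQ : Q.op = c⁻¹ • (H.op * P.op) := by
    rw [h, smul_smul, inv_mul_cancel₀ hc, one_smul]
  have h1 : H.op * (H.op * P.op) = P.op := by
    rw [← mul_assoc, H.op_mul_self, one_mul]
  have h2 : H.op * P.op * H.op = -P.op := by
    rw [ha, neg_mul, mul_assoc, H.op_mul_self, mul_one]
  refine ⟨c⁻¹ * 2, mul_ne_zero (inv_ne_zero hc) two_ne_zero, ?_⟩
  rw [hQ, mul_smul_comm, smul_mul_assoc, h1, h2, ← smul_sub, sub_neg_eq_add, mul_smul, two_smul]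

theorem PauliString.CommutatorProp.irrefl {n : ℕ} (H P : PauliString n) :
    ¬ H.CommutatorProp P P := by
  intro h
  obtain ⟨ha, c, hc, h⟩ := h.spec
  have hH : H.op = c • (1 : QOp n) := by
    calc H.op = H.op * (P.op * P.op) := by rw [P.op_mul_self, mul_one]
      _ = c • (1 : QOp n) := by rw [← mul_assoc, h, smul_mul_assoc, P.op_mul_self]
  rw [hH, smul_mul_assoc, mul_smul_comm, one_mul, mul_one] at ha
  have h2 : (2 : ℂ) • c • P.op = 0 := by
    rw [two_smul]
    exact eq_neg_iff_add_eq_zero.mp ha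
  exact smul_ne_zero two_ne_zero (smul_ne_zero hc P.op_ne_zero) h2

/-- The commutator graph of a set `S` of Pauli strings: the vertices are all Pauli strings, and
`P`, `Q` are joined iff `[H, P] ∝ Q` for some `H ∈ S`. -/
def commutatorGraph {n : ℕ} (S : Set (PauliString n)) : SimpleGraph (PauliString n) where
  Adj P Q := ∃ H ∈ S, H.CommutatorProp P Q
  symm := ⟨fun _ _ ⟨H, hH, h⟩ => ⟨H, hH, h.symm⟩⟩
  loopless := ⟨fun P ⟨H, _, h⟩ => PauliString.CommutatorProp.irrefl H P h⟩

/-- The connected component of `P` in the commutator graph of `S`. -/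
def commutatorComponent {n : ℕ} (S : Set (PauliString n)) (P : PauliString n) :
    Set (PauliString n) :=
  {Q | (commutatorGraph S).Reachable P Q}

/-- The fraction of the Pauli strings in the commutator-graph component of `P` that act
non-trivially only on qubits at distance at most `L` from the support of `P`, for the
connectivity graph `Λ` of the qubits. -/
noncomputable def lightconeFraction {n : ℕ} (Λ : SimpleGraph (Fin n)) (S : Set (PauliString n))
    (P : PauliString n) (L : ℕ) : ℝ :=
  (({Q ∈ commutatorComponent S P |
      ∀ i ∈ Q.support, ∃ j ∈ P.support, Λ.edist i j ≤ (L : ℕ∞)}).ncard : ℝ) /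
    ((commutatorComponent S P).ncard : ℝ)

/-! ### Pauli-compatible groups and invariant states -/

/-- `G` is Pauli-compatible with generators `S`: its elements are the finite products of
`exp(iθP)` with `θ ∈ ℝ` and `P ∈ S`, and the space of operators commuting with `G` is spanned by
Pauli strings. -/
structure IsPauliCompatible {n : ℕ} (G : Subgroup (QUnitary n)) (S : Set (PauliString n)) :
    Prop where
  mem_iff : ∀ U : QUnitary n, U ∈ G ↔ ∃ l : List (ℝ × PauliString n), (∀ p ∈ l, p.2 ∈ S) ∧
    (U : QOp n) = (l.map fun p => NormedSpace.exp (((p.1 : ℂ) * Complex.I) • p.2.op)).prod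
  invariant_eq_span : ∃ B : Set (PauliString n),
    {A : QOp n | ∀ U ∈ G, (U : QOp n) * A * (U : QOp n)ᴴ = A} =
      (Submodule.span ℂ (PauliString.op '' B) : Set (QOp n))

/-- `G` has an invariant state in two copies of the `n`-qubit space: a unit vector fixed by
`U ⊗ U` for all `U ∈ G`. -/
def HasInvariantState {n : ℕ} (G : Subgroup (QUnitary n)) : Prop :=
  ∃ Ψ : QBasis n × QBasis n → ℂ, star Ψ ⬝ᵥ Ψ = 1 ∧
    ∀ U ∈ G, ((U : QOp n) ⊗ₖ (U : QOp n)) *ᵥ Ψ = Ψ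

/-! ### Local circuits -/

/-- `A` acts non-trivially only on the qubits in `s`, i.e. `A = B ⊗ 1` for an operator `B` on the
qubits in `s`, with the identity on the remaining ones. -/
def ActsOn {n : ℕ} (A : QOp n) (s : Set (Fin n)) : Prop :=
  ∃ B : Matrix (s → Fin 2) (s → Fin 2) ℂ,
    (∀ x y : QBasis n, (∀ i ∉ s, x i = y i) → A x y = B (fun i => x i) (fun i => y i)) ∧
    (∀ x y : QBasis n, (∃ i ∉ s, x i ≠ y i) → A x y = 0)

/-- `s` is a single qubit or a pair of neighbouring qubits. -/
def IsTwoLocalSet {n : ℕ} (Λ : SimpleGraph (Fin n)) (s : Set (Fin n)) : Prop :=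
  ∃ i j : Fin n, (i = j ∨ Λ.Adj i j) ∧ s = {i, j}

/-- One time step: a product of gates that act on pairwise disjoint sets of qubits, each of them a
single qubit or a pair of neighbours. -/
def IsTwoLocalLayer {n : ℕ} (Λ : SimpleGraph (Fin n)) (W : QUnitary n) : Prop :=
  ∃ gates : List (Set (Fin n) × QUnitary n),
    (gates.map Prod.fst).Pairwise Disjoint ∧
    (∀ g ∈ gates, IsTwoLocalSet Λ g.1 ∧ ActsOn (g.2 : QOp n) g.1) ∧
    W = (gates.map Prod.snd).prod

/-- `U` is implemented by a circuit of `L` time steps of 2-local gates. -/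
def IsTwoLocalCircuit {n : ℕ} (Λ : SimpleGraph (Fin n)) (L : ℕ) (U : QUnitary n) : Prop :=
  ∃ layers : List (QUnitary n), layers.length = L ∧
    (∀ W ∈ layers, IsTwoLocalLayer Λ W) ∧ U = layers.prod

/-! ### Moment channels and the diamond norm -/

/-- The second-moment channel `X ↦ 𝔼_{U ∼ ν} U^{⊗2} X (U†)^{⊗2}` (the expectation of a matrix is
taken entrywise). -/
noncomputable def secondMoment {n : ℕ} (ν : MeasureTheory.Measure (QUnitary n)) (X : QOp2 n) :
    QOp2 n :=
  Matrix.of fun i j =>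
    ∫ U : QUnitary n,
      (((U : QOp n) ⊗ₖ (U : QOp n)) * X * ((U : QOp n) ⊗ₖ (U : QOp n))ᴴ) i j ∂ν

/-- The trace norm `‖A‖₁ = Tr √(A†A)`, the sum of the singular values of `A`. -/
noncomputable def traceNorm {ι : Type*} [Fintype ι] [DecidableEq ι] (A : Matrix ι ι ℂ) : ℝ :=
  ∑ i, Real.sqrt ((Matrix.isHermitian_conjTranspose_mul_self A).eigenvalues i)

/-- `Φ ⊗ id` on operators on the tensor product with an ancilla. -/
def ampliate {ι κ : Type*} (Φ : Matrix ι ι ℂ → Matrix ι ι ℂ)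
    (ρ : Matrix (ι × κ) (ι × κ) ℂ) : Matrix (ι × κ) (ι × κ) ℂ :=
  Matrix.of fun p q => Φ (Matrix.of fun i j => ρ (i, p.2) (j, q.2)) p.1 q.1

/-- The diamond norm `sup_ρ ‖(Φ ⊗ id_anc) ρ‖₁` of a difference `Φ` of channels, the supremum being
over all density matrices `ρ` on the system together with a finite-dimensional ancilla of any
size. -/
noncomputable def diamondNorm {ι : Type*} [Fintype ι] [DecidableEq ι]
    (Φ : Matrix ι ι ℂ → Matrix ι ι ℂ) : ENNReal :=
  ⨆ (m : ℕ) (ρ : Matrix (ι × Fin m) (ι × Fin m) ℂ) (_ : ρ.PosSemidef ∧ ρ.trace = 1),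
    ENNReal.ofReal (traceNorm (ampliate Φ ρ))

/-! ### Algebra of Pauli matrices and Pauli strings -/

/-! The proof exhibits one state and one measurement that tell the two channels apart. Two copies
are read as operators, so that `U ⊗ U` acts by `A ↦ U A Uᵀ`. The invariant state yields a Pauli
string `K` with `U K Uᵀ = K` on all of `G` (`IsPauliCompatible.exists_invariant_op`). Then `U ⊗ U`
sends the vector of `P K` to the vector of `(U P Uᴴ) K`. The vectors of `Q K` form an orthogonal
basis as `Q` runs over the Pauli strings, and measuring in it gives `Q` with probability `‖coeff Q
(U P Uᴴ)‖ ^ 2` (`trace_reflection_mul_conj`).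

Let `C` be the component of `P` and `T` the part of it inside the light cone. Conjugation by `G`
preserves the span of `C` (`conj_mem_span`), and a depth-`L` circuit spreads supports by at most `L`
(`conj_circuit_mem_suppSpan`), so circuits in `G` put all the weight on `T`. The Haar average
spreads the weight uniformly over `C` (`integral_coeff_sq`), so only `|T| / |C|` falls on `T`; call
this ratio `r`.

The reflection with value `1` on `T` and `-1` elsewhere is unitary and has expectations `1` and `2r
- 1`. Trace duality (`norm_trace_mul_le_traceNorm`) turns their difference into the bound `2(1 -
r)`, already with a trivial ancilla. -/

theorem Pauli.exists_toMatrix_mul (a b : Pauli) :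
    ∃ (z : ℂ) (c : Pauli), a.toMatrix * b.toMatrix = z • c.toMatrix ∧
      (a = .I → b = .I → c = .I) := by
  have hI : ∀ x : Pauli, x.toMatrix * Pauli.I.toMatrix = x.toMatrix := by
    intro x
    rw [show Pauli.I.toMatrix = 1 from Matrix.one_fin_two.symm, mul_one]
  have hI' : ∀ x : Pauli, Pauli.I.toMatrix * x.toMatrix = x.toMatrix := by
    intro x
    rw [show Pauli.I.toMatrix = 1 from Matrix.one_fin_two.symm, one_mul]
  cases a <;> cases b
  case I.I => exact ⟨1, .I, by rw [hI, one_smul], by simp⟩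
  case I.X => exact ⟨1, .X, by rw [hI', one_smul], by simp⟩
  case I.Y => exact ⟨1, .Y, by rw [hI', one_smul], by simp⟩
  case I.Z => exact ⟨1, .Z, by rw [hI', one_smul], by simp⟩
  case X.I => exact ⟨1, .X, by rw [hI, one_smul], by simp⟩
  case Y.I => exact ⟨1, .Y, by rw [hI, one_smul], by simp⟩
  case Z.I => exact ⟨1, .Z, by rw [hI, one_smul], by simp⟩
  case X.Y => exact ⟨Complex.I, .Z, by simp [toMatrix], by simp⟩
  case Y.X => exact ⟨-Complex.I, .Z, by simp [toMatrix], by simp⟩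
  case X.Z => exact ⟨-Complex.I, .Y, by simp [toMatrix], by simp⟩
  case Z.X => exact ⟨Complex.I, .Y, by simp [toMatrix], by simp⟩
  case Y.Z => exact ⟨Complex.I, .X, by simp [toMatrix], by simp⟩
  case Z.Y => exact ⟨-Complex.I, .X, by simp [toMatrix], by simp⟩
  all_goals exact ⟨1, .I, by simp [toMatrix], by simp⟩

theorem Pauli.toMatrix_I : Pauli.I.toMatrix = 1 := Matrix.one_fin_two.symm

theorem Pauli.trace_mul (a b : Pauli) :
    (a.toMatrix * b.toMatrix).trace = if a = b then 2 else 0 := by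
  cases a <;> cases b <;> simp [toMatrix, Matrix.trace_fin_two] <;> norm_num

theorem Pauli.sum_univ {M : Type*} [AddCommMonoid M] (f : Pauli → M) :
    ∑ a, f a = f .I + f .X + f .Y + f .Z := by
  rw [show (Finset.univ : Finset Pauli) = {.I, .X, .Y, .Z} from rfl]
  rw [Finset.sum_insert (by decide), Finset.sum_insert (by decide), Finset.sum_insert (by decide),
    Finset.sum_singleton, add_assoc, add_assoc]

theorem Pauli.sum_trace_smul (M : Matrix (Fin 2) (Fin 2) ℂ) :
    ∑ a : Pauli, ((a.toMatrix * M).trace / 2) • a.toMatrix = M := by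
  rw [Pauli.sum_univ, M.eta_fin_two]
  generalize M 0 0 = a, M 0 1 = b, M 1 0 = c, M 1 1 = d
  have hI := Complex.I_mul_I
  ext i j
  fin_cases i <;> fin_cases j <;> simp [toMatrix, Matrix.trace_fin_two] <;> grind

theorem Pauli.conjTranspose_toMatrix (a : Pauli) : a.toMatrixᴴ = a.toMatrix := by
  cases a <;> ext i j <;> fin_cases i <;> fin_cases j <;> simp [toMatrix]

theorem Pauli.transpose_toMatrix (a : Pauli) :
    ∃ s : ℂ, (s = 1 ∨ s = -1) ∧ a.toMatrixᵀ = s • a.toMatrix := by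
  cases a
  case Y => exact ⟨-1, Or.inr rfl, by ext i j; fin_cases i <;> fin_cases j <;> simp [toMatrix]⟩
  all_goals exact ⟨1, Or.inl rfl, by ext i j; fin_cases i <;> fin_cases j <;> simp [toMatrix]⟩

theorem tensorOp_trace {n : ℕ} (A : Fin n → Matrix (Fin 2) (Fin 2) ℂ) :
    (tensorOp A).trace = ∏ i, (A i).trace := by
  simp only [Matrix.trace, Matrix.diag, tensorOp, Matrix.of_apply]
  exact (Fintype.prod_sum fun (i : Fin n) (y : Fin 2) => A i y y).symm

theorem tensorOp_sum {n : ℕ} (c : Fin n → Pauli → ℂ) :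
    tensorOp (fun i => ∑ a, c i a • a.toMatrix) =
      ∑ R : PauliString n, (∏ i, c i (R i)) • R.op := by
  ext x y
  simp only [tensorOp, Matrix.of_apply, Matrix.sum_apply, Matrix.smul_apply, smul_eq_mul,
    PauliString.op, ← Finset.prod_mul_distrib]
  exact Fintype.prod_sum fun (i : Fin n) (a : Pauli) => c i a * a.toMatrix (x i) (y i)

theorem tensorOp_single {n : ℕ} (x y : QBasis n) :
    tensorOp (fun i => Matrix.single (x i) (y i) (1 : ℂ)) = Matrix.single x y 1 := by
  ext u v
  simp only [tensorOp, Matrix.of_apply, Matrix.single_apply]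
  by_cases h : x = u ∧ y = v
  · rw [if_pos h]
    exact Finset.prod_eq_one fun i _ => by simp [h.1, h.2]
  · rw [if_neg h]
    have : ∃ i, ¬ (x i = u i ∧ y i = v i) := by
      by_contra hc
      push Not at hc
      exact h ⟨funext fun i => (hc i).1, funext fun i => (hc i).2⟩
    obtain ⟨i, hi⟩ := this
    exact Finset.prod_eq_zero (Finset.mem_univ i) (if_neg hi)

namespace PauliString

variable {n : ℕ}

theorem conjTranspose_op (P : PauliString n) : P.opᴴ = P.op := by
  ext x y
  simp only [op, tensorOp, Matrix.conjTranspose_apply, Matrix.of_apply, star_prod]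
  refine Finset.prod_congr rfl fun i _ => ?_
  conv_rhs => rw [← Pauli.conjTranspose_toMatrix (P i)]
  rfl

theorem transpose_op (P : PauliString n) : P.opᵀ = P.op ∨ P.opᵀ = -P.op := by
  choose s hs h using fun i => Pauli.transpose_toMatrix (P i)
  have hp : (∏ i, s i) = 1 ∨ (∏ i, s i) = -1 := by
    refine Finset.prod_induction s (fun z => z = 1 ∨ z = -1) ?_ (Or.inl rfl) (fun i _ => hs i)
    rintro a b (rfl | rfl) (rfl | rfl) <;> simp
  have hm : P.opᵀ = (∏ i, s i) • P.op := by
    rw [op, ← tensorOp_smul]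
    ext x y
    simp only [tensorOp, Matrix.transpose_apply, Matrix.of_apply]
    refine Finset.prod_congr rfl fun i _ => ?_
    rw [← h i, Matrix.transpose_apply]
  rcases hp with hp | hp
  · left; rw [hm, hp, one_smul]
  · right; rw [hm, hp, neg_one_smul]

/-- Pauli strings are closed under multiplication, up to scalars. -/
theorem exists_op_mul (P Q : PauliString n) :
    ∃ (z : ℂ) (R : PauliString n), P.op * Q.op = z • R.op ∧
      R.support ⊆ P.support ∪ Q.support := by
  choose z R h hI using fun i => Pauli.exists_toMatrix_mul (P i) (Q i)
  refine ⟨∏ i, z i, R, ?_, ?_⟩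
  · simp only [op, tensorOp_mul, h, tensorOp_smul]
  · intro i hi
    by_contra hc
    simp only [support, Set.mem_union, Set.mem_ofPred_eq, not_or, not_not] at hc
    exact hi (hI i hc.1 hc.2)

theorem trace_op_mul (P Q : PauliString n) :
    (P.op * Q.op).trace = if P = Q then 2 ^ n else 0 := by
  simp only [op, tensorOp_mul, tensorOp_trace, Pauli.trace_mul]
  by_cases h : P = Q
  · simp [h]
  · obtain ⟨i, hi⟩ := Function.ne_iff.mp h
    rw [if_neg h]
    exact Finset.prod_eq_zero (Finset.mem_univ i) (if_neg hi)

theorem op_mul_comm_of_disjoint {P Q : PauliString n} (h : Disjoint P.support Q.support) :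
    P.op * Q.op = Q.op * P.op := by
  simp only [op, tensorOp_mul]
  congr 1
  funext i
  by_cases hi : P i = .I
  · rw [hi, Pauli.toMatrix_I, one_mul, mul_one]
  · have : Q i = .I := by
      by_contra hq
      exact Set.disjoint_left.mp h hi hq
    rw [this, Pauli.toMatrix_I, one_mul, mul_one]

/-- The operators spanned by the Pauli strings supported in `s`. -/
noncomputable def suppSpan (s : Set (Fin n)) : Submodule ℂ (QOp n) :=
  Submodule.span ℂ (op '' {R : PauliString n | R.support ⊆ s})

theorem suppSpan_mono {s t : Set (Fin n)} (h : s ⊆ t) : suppSpan s ≤ suppSpan t :=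
  Submodule.span_mono (Set.image_mono fun _ hR => Set.Subset.trans hR h)

theorem op_mem_suppSpan {P : PauliString n} {s : Set (Fin n)} (h : P.support ⊆ s) :
    P.op ∈ suppSpan s :=
  Submodule.subset_span ⟨P, h, rfl⟩

theorem mul_mem_suppSpan {A B : QOp n} {s : Set (Fin n)} (hA : A ∈ suppSpan s)
    (hB : B ∈ suppSpan s) : A * B ∈ suppSpan s := by
  induction hA using Submodule.span_induction with
  | zero => simp
  | add x y _ _ hx hy => rw [add_mul]; exact add_mem hx hy
  | smul c x _ hx => rw [smul_mul_assoc]; exact Submodule.smul_mem _ c hx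
  | mem x hx =>
    obtain ⟨P, hP, rfl⟩ := hx
    induction hB using Submodule.span_induction with
    | zero => simp
    | add x y _ _ hx hy => rw [mul_add]; exact add_mem hx hy
    | smul c x _ hx => rw [mul_smul_comm]; exact Submodule.smul_mem _ c hx
    | mem x hx =>
      obtain ⟨Q, hQ, rfl⟩ := hx
      obtain ⟨z, R, h, hR⟩ := exists_op_mul P Q
      rw [h]
      exact Submodule.smul_mem _ z (op_mem_suppSpan (hR.trans (Set.union_subset hP hQ)))

theorem conjTranspose_mem_suppSpan {A : QOp n} {s : Set (Fin n)} (hA : A ∈ suppSpan s) :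
    Aᴴ ∈ suppSpan s := by
  induction hA using Submodule.span_induction with
  | zero => simp
  | add x y _ _ hx hy => rw [Matrix.conjTranspose_add]; exact add_mem hx hy
  | smul c x _ hx => rw [Matrix.conjTranspose_smul]; exact Submodule.smul_mem _ _ hx
  | mem x hx =>
    obtain ⟨P, hP, rfl⟩ := hx
    rw [conjTranspose_op]
    exact op_mem_suppSpan hP

theorem mul_comm_of_mem_suppSpan {A B : QOp n} {s t : Set (Fin n)} (hst : Disjoint s t)
    (hA : A ∈ suppSpan s) (hB : B ∈ suppSpan t) : A * B = B * A := by
  induction hA using Submodule.span_induction with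
  | zero => simp
  | add x y _ _ hx hy => rw [add_mul, mul_add, hx, hy]
  | smul c x _ hx => rw [smul_mul_assoc, hx, mul_smul_comm]
  | mem x hx =>
    obtain ⟨P, hP, rfl⟩ := hx
    induction hB using Submodule.span_induction with
    | zero => simp
    | add x y _ _ hx hy => rw [add_mul, mul_add, hx, hy]
    | smul c x _ hx => rw [smul_mul_assoc, mul_smul_comm, hx]
    | mem x hx =>
      obtain ⟨Q, hQ, rfl⟩ := hx
      exact op_mul_comm_of_disjoint (hst.mono hP hQ)

/-- Expand every factor in Pauli matrices. A string with a letter other than `I` outside `s` gets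
coefficient zero, since that letter is traceless and the factor there is `1`. -/
theorem tensorOp_mem_suppSpan {A : Fin n → Matrix (Fin 2) (Fin 2) ℂ} {s : Set (Fin n)}
    (h : ∀ i ∉ s, A i = 1) : tensorOp A ∈ suppSpan s := by
  have hA : A = fun i => ∑ a : Pauli, ((a.toMatrix * A i).trace / 2) • a.toMatrix :=
    funext fun i => (Pauli.sum_trace_smul (A i)).symm
  rw [hA, tensorOp_sum]
  refine Submodule.sum_mem _ fun R _ => ?_
  by_cases hR : R.support ⊆ s
  · exact Submodule.smul_mem _ _ (op_mem_suppSpan hR)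
  · obtain ⟨i, hi, his⟩ := Set.not_subset.mp hR
    rw [Finset.prod_eq_zero (Finset.mem_univ i), zero_smul]
    · exact Submodule.zero_mem _
    · rw [h i his, ← Pauli.toMatrix_I, Pauli.trace_mul, if_neg hi, zero_div]

theorem suppSpan_univ : suppSpan (Set.univ : Set (Fin n)) = ⊤ := by
  rw [eq_top_iff]
  intro A _
  rw [Matrix.matrix_eq_sum_single A]
  refine Submodule.sum_mem _ fun x _ => Submodule.sum_mem _ fun y _ => ?_
  rw [← mul_one (A x y), ← smul_eq_mul, ← Matrix.smul_single, ← tensorOp_single]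
  exact Submodule.smul_mem _ _ (tensorOp_mem_suppSpan fun i hi => absurd (Set.mem_univ i) hi)

theorem _root_.ActsOn.mem_suppSpan {A : QOp n} {s : Set (Fin n)} (h : ActsOn A s) :
    A ∈ suppSpan s := by
  classical
  obtain ⟨B, h1, h2⟩ := h
  -- Expanding `B` in matrix units makes each term a tensor product that is `1` off `s`.
  have hA : A = ∑ a : s → Fin 2, ∑ b : s → Fin 2, B a b • tensorOp fun i =>
      if hi : i ∈ s then Matrix.single (a ⟨i, hi⟩) (b ⟨i, hi⟩) (1 : ℂ) else 1 := by
    ext x y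
    simp only [Matrix.sum_apply, Matrix.smul_apply, smul_eq_mul, tensorOp, Matrix.of_apply]
    rw [Finset.sum_eq_single fun i : s => x i, Finset.sum_eq_single fun i : s => y i]
    · by_cases hxy : ∀ i ∉ s, x i = y i
      · rw [h1 x y hxy, Finset.prod_eq_one, mul_one]
        intro i _
        by_cases hi : i ∈ s
        · simp [hi]
        · rw [dif_neg hi, hxy i hi, Matrix.one_apply_eq]
      · push Not at hxy
        obtain ⟨i, hi, hne⟩ := hxy
        rw [h2 x y ⟨i, hi, hne⟩, Finset.prod_eq_zero (Finset.mem_univ i), mul_zero]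
        simp [hi, hne]
    · intro b _ hb
      obtain ⟨i, hi⟩ := Function.ne_iff.mp hb
      rw [Finset.prod_eq_zero (Finset.mem_univ (i : Fin n)), mul_zero]
      simp [hi]
    · simp
    · intro a _ ha
      obtain ⟨i, hi⟩ := Function.ne_iff.mp ha
      refine Finset.sum_eq_zero fun b _ => ?_
      rw [Finset.prod_eq_zero (Finset.mem_univ (i : Fin n)), mul_zero]
      simp [hi]
    · simp
  rw [hA]
  refine Submodule.sum_mem _ fun a _ => Submodule.sum_mem _ fun b _ => ?_
  exact Submodule.smul_mem _ _ (tensorOp_mem_suppSpan fun i hi => by simp [hi])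

/-- The coefficient of `R` in the Pauli expansion of `A`. -/
noncomputable def coeff (R : PauliString n) (A : QOp n) : ℂ := (R.op * A).trace / 2 ^ n

theorem coeff_op (R Q : PauliString n) : coeff R Q.op = if R = Q then 1 else 0 := by
  rw [coeff, trace_op_mul]
  split_ifs
  · exact div_self (pow_ne_zero n two_ne_zero)
  · exact zero_div _

theorem coeff_smul (R : PauliString n) (c : ℂ) (A : QOp n) :
    coeff R (c • A) = c * coeff R A := by
  rw [coeff, coeff, mul_smul_comm, Matrix.trace_smul, smul_eq_mul, mul_div_assoc]

theorem coeff_add (R : PauliString n) (A B : QOp n) :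
    coeff R (A + B) = coeff R A + coeff R B := by
  rw [coeff, coeff, coeff, mul_add, Matrix.trace_add, add_div]

theorem coeff_eq_zero_of_mem_span {s : Set (PauliString n)} {R : PauliString n} (hR : R ∉ s)
    {A : QOp n} (hA : A ∈ Submodule.span ℂ (op '' s)) : coeff R A = 0 := by
  induction hA using Submodule.span_induction with
  | zero => simp [coeff]
  | add x y _ _ hx hy => rw [coeff_add, hx, hy, add_zero]
  | smul c x _ hx => rw [coeff_smul, hx, mul_zero]
  | mem x hx =>
    obtain ⟨Q, hQ, rfl⟩ := hx
    rw [coeff_op, if_neg]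
    rintro rfl
    exact hR hQ

theorem sum_coeff_smul (A : QOp n) : ∑ R : PauliString n, coeff R A • R.op = A := by
  have hA : A ∈ suppSpan (Set.univ : Set (Fin n)) := by rw [suppSpan_univ]; trivial
  induction hA using Submodule.span_induction with
  | zero => simp [coeff]
  | add x y _ _ hx hy => simp only [coeff_add, add_smul, Finset.sum_add_distrib, hx, hy]
  | smul c x _ hx => simp only [coeff_smul, mul_smul, ← Finset.smul_sum, hx]
  | mem x hx =>
    obtain ⟨Q, _, rfl⟩ := hx
    simp [coeff_op]

/-- Parseval's identity for the Pauli expansion. -/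
theorem sum_norm_coeff_sq (A : QOp n) :
    ((∑ R : PauliString n, ‖coeff R A‖ ^ 2 : ℝ) : ℂ) = (Aᴴ * A).trace / 2 ^ n := by
  conv_rhs => rw [← sum_coeff_smul A]
  simp only [Matrix.conjTranspose_sum, Matrix.conjTranspose_smul, conjTranspose_op,
    Finset.sum_mul, Finset.mul_sum, Matrix.trace_sum, smul_mul_assoc, mul_smul_comm,
    Matrix.trace_smul, trace_op_mul, smul_eq_mul, mul_ite, mul_zero, Finset.sum_div]
  push_cast
  refine Finset.sum_congr rfl fun R _ => ?_
  rw [Finset.sum_eq_single R (fun Q _ hQ => by rw [if_neg hQ, zero_div]) (by simp), if_pos rfl,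
    ← mul_assoc, mul_div_assoc, div_self (pow_ne_zero n two_ne_zero), mul_one,
    Complex.star_def, Complex.mul_conj']

end PauliString

/-! ### Exponentials of Pauli strings -/

/-- The idempotents `(1 ± x) / 2` are orthogonal and sum to `1`, so they define a continuous ring
homomorphism from `ℂ × ℂ`, where the exponential is componentwise. -/
theorem NormedSpace.exp_smul_of_mul_self_eq_one {A : Type*} [NormedRing A] [NormedAlgebra ℂ A]
    [CompleteSpace A] [Algebra ℚ A] {x : A} (hx : x * x = 1) (z : ℂ) :
    NormedSpace.exp (z • x) = Complex.cosh z • (1 : A) + Complex.sinh z • x := by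
  have hpp : ((1 / 2 : ℂ) • (1 + x)) * ((1 / 2 : ℂ) • (1 + x)) = (1 / 2 : ℂ) • (1 + x) := by
    rw [smul_mul_smul_comm, add_mul, mul_add, one_mul, one_mul, mul_add, hx, mul_one]
    module
  have hmm : ((1 / 2 : ℂ) • (1 - x)) * ((1 / 2 : ℂ) • (1 - x)) = (1 / 2 : ℂ) • (1 - x) := by
    rw [smul_mul_smul_comm, sub_mul, mul_sub, one_mul, one_mul, mul_sub, hx, mul_one]
    module
  have hpm : ((1 / 2 : ℂ) • (1 + x)) * ((1 / 2 : ℂ) • (1 - x)) = 0 := by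
    rw [smul_mul_smul_comm, add_mul, mul_sub, one_mul, one_mul, mul_sub, hx, mul_one]
    module
  have hmp : ((1 / 2 : ℂ) • (1 - x)) * ((1 / 2 : ℂ) • (1 + x)) = 0 := by
    rw [smul_mul_smul_comm, sub_mul, mul_add, one_mul, one_mul, mul_add, hx, mul_one]
    module
  generalize hp : (1 / 2 : ℂ) • (1 + x) = p at *
  generalize hm : (1 / 2 : ℂ) • (1 - x) = m at *
  let f : ℂ × ℂ →+* A :=
    { toFun := fun w => w.1 • p + w.2 • m
      map_one' := by
        simp only [Prod.fst_one, Prod.snd_one, ← hp, ← hm]; module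
      map_zero' := by simp
      map_add' := fun u v => by simp only [Prod.fst_add, Prod.snd_add]; module
      map_mul' := fun u v => by
        simp only [Prod.fst_mul, Prod.snd_mul, add_mul, mul_add, smul_mul_smul_comm, hpp, hmm, hpm,
          hmp, smul_zero, add_zero, zero_add] }
  have hf : Continuous f := by
    change Continuous fun w : ℂ × ℂ => w.1 • p + w.2 • m
    fun_prop
  have h1 : z • x = f (z, -z) := by
    change z • x = z • p + (-z) • m
    rw [← hp, ← hm]; module
  have h2 : NormedSpace.exp ((z, -z) : ℂ × ℂ) = (Complex.exp z, Complex.exp (-z)) := by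
    refine Prod.ext ?_ ?_
    · rw [Prod.fst_exp, Complex.exp_eq_exp_ℂ]
    · rw [Prod.snd_exp, Complex.exp_eq_exp_ℂ]
  rw [h1, ← NormedSpace.map_exp f hf, h2]
  change Complex.exp z • p + Complex.exp (-z) • m = _
  rw [← hp, ← hm, ← Complex.cosh_add_sinh, Complex.exp_neg, ← Complex.cosh_add_sinh z]
  rw [Complex.cosh_add_sinh, ← Complex.exp_neg, ← Complex.cosh_sub_sinh, ← Complex.cosh_add_sinh]
  module

/-- This is the dictionary between vectors on two copies and operators on one. -/
theorem Matrix.kronecker_mulVec_entries {ι κ R : Type*} [Fintype ι] [Fintype κ] [CommSemiring R]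
    (U : Matrix ι ι R) (V : Matrix κ κ R) (A : Matrix ι κ R) :
    (U ⊗ₖ V) *ᵥ (fun x => A x.1 x.2) = fun x => (U * A * Vᵀ) x.1 x.2 := by
  ext ⟨x, y⟩
  rw [Matrix.mulVec, dotProduct, Fintype.sum_prod_type]
  simp only [Matrix.mul_apply, Finset.sum_mul, Matrix.transpose_apply, Matrix.kroneckerMap_apply]
  rw [Finset.sum_comm]
  refine Finset.sum_congr rfl fun a _ => Finset.sum_congr rfl fun b _ => ?_
  ring

namespace PauliString

variable {n : ℕ}

open scoped Matrix.Norms.Operator in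
theorem exp_smul_op (H : PauliString n) (θ : ℝ) :
    NormedSpace.exp (((θ : ℂ) * Complex.I) • H.op) =
      Complex.cos θ • (1 : QOp n) + (Complex.sin θ * Complex.I) • H.op := by
  refine (NormedSpace.exp_smul_of_mul_self_eq_one H.op_mul_self _).trans ?_
  rw [Complex.cosh_mul_I, Complex.sinh_mul_I]

/-- The unitary `exp (iθH)`. -/
noncomputable def rot (H : PauliString n) (θ : ℝ) : QOp n :=
  Complex.cos θ • (1 : QOp n) + (Complex.sin θ * Complex.I) • H.op

theorem conjTranspose_rot (H : PauliString n) (θ : ℝ) :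
    (H.rot θ)ᴴ = Complex.cos θ • (1 : QOp n) - (Complex.sin θ * Complex.I) • H.op := by
  rw [rot, Matrix.conjTranspose_add, Matrix.conjTranspose_smul, Matrix.conjTranspose_smul,
    Matrix.conjTranspose_one, conjTranspose_op, sub_eq_add_neg, ← neg_smul]
  simp [← Complex.ofReal_cos, ← Complex.ofReal_sin, Complex.conj_ofReal]

theorem rot_mul_conjTranspose (H : PauliString n) (θ : ℝ) : H.rot θ * (H.rot θ)ᴴ = 1 := by
  rw [conjTranspose_rot, rot, add_mul, mul_sub, mul_sub, smul_mul_smul_comm, smul_mul_smul_comm,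
    smul_mul_smul_comm, smul_mul_smul_comm, one_mul, one_mul, mul_one, H.op_mul_self]
  have h : Complex.cos θ * Complex.cos θ -
      (Complex.sin θ * Complex.I) * (Complex.sin θ * Complex.I) = 1 := by
    have := Complex.cos_sq_add_sin_sq (θ : ℂ)
    have hI := Complex.I_mul_I
    grind
  conv_rhs => rw [← one_smul ℂ (1 : QOp n), ← h]
  module

theorem rot_conj_of_comm {H : PauliString n} {A : QOp n} (h : H.op * A = A * H.op)
    (θ : ℝ) : H.rot θ * A * (H.rot θ)ᴴ = A := by
  have : H.rot θ * A = A * H.rot θ := by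
    rw [rot, add_mul, mul_add, smul_mul_assoc, smul_mul_assoc, mul_smul_comm, mul_smul_comm, h,
      one_mul, mul_one]
  rw [this, mul_assoc, rot_mul_conjTranspose, mul_one]

/-- Moving the right factor through `A` turns it into a second `H.rot θ`, hence the double angle. At
`θ = π/4` only `i H A` survives, which realises an edge of the commutator graph. -/
theorem rot_conj_of_anticomm {H : PauliString n} {A : QOp n} (h : H.op * A = -(A * H.op))
    (θ : ℝ) : H.rot θ * A * (H.rot θ)ᴴ =
      Complex.cos (2 * θ) • A + (Complex.sin (2 * θ) * Complex.I) • (H.op * A) := by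
  have h3 : H.op * A * H.op = -A := by
    rw [h, neg_mul, mul_assoc, H.op_mul_self, mul_one]
  have h4 : A * H.op = -(H.op * A) := by rw [h, neg_neg]
  rw [conjTranspose_rot, rot, add_mul, mul_sub, smul_mul_assoc, smul_mul_assoc, one_mul]
  simp only [add_mul, mul_smul_comm, smul_mul_assoc, mul_one, h3, h4]
  have hI := Complex.I_mul_I
  have hc : Complex.cos (2 * θ) = Complex.cos θ * Complex.cos θ +
      (Complex.sin θ * Complex.I) * (Complex.sin θ * Complex.I) := by
    have := Complex.cos_sq_add_sin_sq (θ : ℂ)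
    rw [Complex.cos_two_mul]
    grind
  rw [hc, Complex.sin_two_mul]
  module

theorem rot_conj_mem_span {S : Set (PauliString n)} {P H : PauliString n} (hH : H ∈ S) (θ : ℝ)
    {A : QOp n} (hA : A ∈ Submodule.span ℂ (op '' commutatorComponent S P)) :
    H.rot θ * A * (H.rot θ)ᴴ ∈ Submodule.span ℂ (op '' commutatorComponent S P) := by
  induction hA using Submodule.span_induction with
  | zero => simp
  | add x y _ _ hx hy => rw [mul_add, add_mul]; exact add_mem hx hy
  | smul c x _ hx => rw [mul_smul_comm, smul_mul_assoc]; exact Submodule.smul_mem _ c hx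
  | mem x hx =>
    obtain ⟨Q, hQ, rfl⟩ := hx
    rcases op_mul_comm H Q with h | h
    · rw [rot_conj_of_comm h]
      exact Submodule.subset_span ⟨Q, hQ, rfl⟩
    · rw [rot_conj_of_anticomm h]
      refine add_mem (Submodule.smul_mem _ _ (Submodule.subset_span ⟨Q, hQ, rfl⟩))
        (Submodule.smul_mem _ _ ?_)
      obtain ⟨z, R, hR, -⟩ := exists_op_mul H Q
      rw [hR]
      -- The scalar never vanishes, but the case split is cheaper than proving so.
      by_cases hz : z = 0
      · rw [hz, zero_smul]; exact Submodule.zero_mem _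
      refine Submodule.smul_mem _ _ (Submodule.subset_span ⟨R, ?_, rfl⟩)
      have hadj : (commutatorGraph S).Adj Q R := by
        refine ⟨H, hH, 2 * z, mul_ne_zero two_ne_zero hz, ?_⟩
        rw [show Q.op * H.op = -(H.op * Q.op) by rw [h, neg_neg], sub_neg_eq_add, hR, ← two_smul ℂ,
          smul_smul]
      exact SimpleGraph.Reachable.trans hQ hadj.reachable

end PauliString

/-! ### Orbits of Pauli strings under the group and the invariant string -/

namespace IsPauliCompatible

variable {n : ℕ} {G : Subgroup (QUnitary n)} {S : Set (PauliString n)}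

theorem rot_mem (hG : IsPauliCompatible G S) {H : PauliString n} (hH : H ∈ S) (θ : ℝ) :
    ∃ V ∈ G, (V : QOp n) = H.rot θ := by
  have hu : H.rot θ ∈ Matrix.unitaryGroup (QBasis n) ℂ :=
    Matrix.mem_unitaryGroup_iff.mpr (H.rot_mul_conjTranspose θ)
  refine ⟨⟨H.rot θ, hu⟩, (hG.mem_iff _).mpr ⟨[(θ, H)], by simpa using hH, ?_⟩, rfl⟩
  simp only [List.map_cons, List.map_nil, List.prod_cons, List.prod_nil, mul_one]
  exact (H.exp_smul_op θ).symm

/-- A property of operators that holds for `1` and is stable under left multiplication by the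
generators holds on the group. -/
theorem induction_on (hG : IsPauliCompatible G S) {p : QOp n → Prop} (h1 : p 1)
    (hmul : ∀ H ∈ S, ∀ (θ : ℝ) (A : QOp n), p A → p (H.rot θ * A)) {U : QUnitary n} (hU : U ∈ G) :
    p U := by
  obtain ⟨l, hl, h⟩ := (hG.mem_iff U).mp hU
  rw [h]
  clear h
  induction l with
  | nil => simpa using h1
  | cons a l ih =>
    rw [List.map_cons, List.prod_cons, PauliString.exp_smul_op]
    exact hmul _ (hl a (by simp)) _ _ (ih fun b hb => hl b (by simp [hb]))

theorem conj_mem_span (hG : IsPauliCompatible G S) {U : QUnitary n} (hU : U ∈ G)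
    (P : PauliString n) : (U : QOp n) * P.op * (U : QOp n)ᴴ ∈
      Submodule.span ℂ (PauliString.op '' commutatorComponent S P) := by
  refine hG.induction_on (p := fun A => A * P.op * Aᴴ ∈
      Submodule.span ℂ (PauliString.op '' commutatorComponent S P)) ?_ ?_ hU
  · rw [one_mul, Matrix.conjTranspose_one, mul_one]
    exact Submodule.subset_span ⟨P, SimpleGraph.Reachable.refl P, rfl⟩
  · intro H hH θ A hA
    have := PauliString.rot_conj_mem_span hH θ hA
    rwa [Matrix.conjTranspose_mul, show H.rot θ * A * P.op * (Aᴴ * (H.rot θ)ᴴ) =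
      H.rot θ * (A * P.op * Aᴴ) * (H.rot θ)ᴴ by noncomm_ring]

/-- If the group has an invariant state, then it leaves a Pauli string `K` invariant under
`K ↦ U K Uᵀ`. -/
theorem exists_invariant_op (hG : IsPauliCompatible G S) (hinv : HasInvariantState G) :
    ∃ K : PauliString n, ∀ U ∈ G, (U : QOp n) * K.op * (U : QOp n)ᵀ = K.op := by
  obtain ⟨Ψ, hΨ, hfix⟩ := hinv
  let Ω : QOp n := Matrix.of fun x y => Ψ (x, y)
  have hΩ : Ω ≠ 0 := by
    intro h0
    have : Ψ = 0 := funext fun x => congrFun (congrFun h0 x.1) x.2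
    simp [this] at hΨ
  have hU : ∀ U ∈ G, (U : QOp n) * Ω * (U : QOp n)ᵀ = Ω := by
    intro U hU
    ext x y
    have := Matrix.kronecker_mulVec_entries (U : QOp n) U Ω
    change ((U : QOp n) ⊗ₖ (U : QOp n)) *ᵥ Ψ = _ at this
    rw [hfix U hU] at this
    exact (congrFun this (x, y)).symm
  have hanti : ∀ H ∈ S, H.op * Ω * H.opᵀ = -Ω := by
    intro H hH
    -- At angle `π/2` the rotation is `iH`, and the two factors `i` produce the sign.
    obtain ⟨V, hV, hVe⟩ := hG.rot_mem hH (Real.pi / 2)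
    have h := hU V hV
    rw [hVe, PauliString.rot, ← Complex.ofReal_cos, ← Complex.ofReal_sin, Real.cos_pi_div_two,
      Real.sin_pi_div_two, Complex.ofReal_zero, zero_smul, zero_add, Complex.ofReal_one, one_mul,
      Matrix.transpose_smul, smul_mul_assoc, smul_mul_assoc, mul_smul_comm, smul_smul,
      Complex.I_mul_I, neg_one_smul] at h
    rw [← neg_eq_iff_eq_neg, h]
  -- `Ω` need not be unitary, so it is replaced by any string in its Pauli expansion. Each generator
  -- acts on strings by `K ↦ H K Hᵀ = ±K`, so every string occurring in `Ω` carries the sign `-1`.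
  obtain ⟨K, hK⟩ : ∃ K : PauliString n, K.coeff Ω ≠ 0 := by
    by_contra hc
    push Not at hc
    apply hΩ
    rw [← PauliString.sum_coeff_smul Ω]
    simp [hc]
  have hKS : ∀ H ∈ S, H.op * K.op = -(K.op * H.opᵀ) := by
    intro H hH
    have key : K.op * H.opᵀ = H.op * K.op ∨ K.op * H.opᵀ = -(H.op * K.op) := by
      rcases H.transpose_op with ht | ht <;> rcases H.op_mul_comm K with h | h <;> rw [ht, h] <;>
        simp
    rcases key with h | h
    -- In the `+1` case the trace against `Ω` equals its own negative, so `K` would not occur in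
    -- `Ω`.
    · exfalso
      apply hK
      have htr : (K.op * Ω).trace = -(K.op * Ω).trace := by
        have h5 : H.opᵀ * H.opᵀ = 1 := by
          rw [← Matrix.transpose_mul, H.op_mul_self, Matrix.transpose_one]
        have h6 : H.opᵀ * (K.op * H.op) = K.op := by
          have h7 : H.opᵀ * K.op = K.op * H.op := by
            rcases H.transpose_op with ht | ht <;> rw [ht] at h ⊢
            · rw [h]
            · rw [mul_neg] at h; rw [neg_mul, ← h, neg_neg]
          rw [← h7, ← mul_assoc, h5, one_mul]
        conv_rhs => rw [← Matrix.trace_neg, ← mul_neg, ← hanti H hH]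
        rw [show K.op * (H.op * Ω * H.opᵀ) = K.op * H.op * Ω * H.opᵀ by noncomm_ring,
          Matrix.trace_mul_comm (K.op * H.op * Ω), ← mul_assoc, h6]
      rw [PauliString.coeff, self_eq_neg.mp htr, zero_div]
    · rw [h, neg_neg]
  refine ⟨K, fun U hU => ?_⟩
  refine hG.induction_on (p := fun A => A * K.op * Aᵀ = K.op) (by simp) ?_ hU
  intro H hH θ A hA
  rw [Matrix.transpose_mul, show H.rot θ * A * K.op * (Aᵀ * (H.rot θ)ᵀ) =
      H.rot θ * (A * K.op * Aᵀ) * (H.rot θ)ᵀ by noncomm_ring, hA]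
  -- Passing through `K` replaces `H` by `-Hᵀ`, which reverses the angle.
  have h1 : H.rot θ * K.op = K.op * (H.rot θ)ᴴᵀ := by
    rw [PauliString.conjTranspose_rot, PauliString.rot, add_mul, Matrix.transpose_sub,
      Matrix.transpose_smul, Matrix.transpose_smul, Matrix.transpose_one, mul_sub, smul_mul_assoc,
      smul_mul_assoc, mul_smul_comm, mul_smul_comm, one_mul, mul_one, hKS H hH, smul_neg,
      sub_eq_add_neg]
  rw [h1, mul_assoc, ← Matrix.transpose_mul, PauliString.rot_mul_conjTranspose,
    Matrix.transpose_one, mul_one]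

end IsPauliCompatible

/-! ### Light cones of local circuits -/

/-- The qubits at distance at most `L` from `s`. -/
def SimpleGraph.edistBall {V : Type*} (Λ : SimpleGraph V) (s : Set V) (L : ℕ) : Set V :=
  {i | ∃ j ∈ s, Λ.edist i j ≤ (L : ℕ∞)}

namespace PauliString

variable {n : ℕ} {Λ : SimpleGraph (Fin n)}

/-- Conjugation by a product of gates with disjoint supports enlarges the support of an operator
only by the gates that meet it. -/
theorem conj_gates_mem_suppSpan (gates : List (Set (Fin n) × QUnitary n))
    (hd : (gates.map Prod.fst).Pairwise Disjoint)
    (hg : ∀ g ∈ gates, ActsOn (g.2 : QOp n) g.1) {s : Set (Fin n)} {A : QOp n}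
    (hA : A ∈ suppSpan s) :
    ((gates.map Prod.snd).prod : QUnitary n) * A *
        (((gates.map Prod.snd).prod : QUnitary n) : QOp n)ᴴ ∈
      suppSpan (s ∪ {i | ∃ g ∈ gates, i ∈ g.1 ∧ ¬ Disjoint g.1 s}) := by
  induction gates with
  | nil => simpa using hA
  | cons g gates ih =>
    rw [List.map_cons, List.pairwise_cons] at hd
    have ih := ih hd.2 fun g' hg' => hg g' (List.mem_cons_of_mem _ hg')
    have hgs : (g.2 : QOp n) ∈ suppSpan g.1 := (hg g List.mem_cons_self).mem_suppSpan
    rw [List.map_cons, List.prod_cons]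
    set W : QUnitary n := (gates.map Prod.snd).prod
    have hconj : ((g.2 * W : QUnitary n) : QOp n) * A * ((g.2 * W : QUnitary n) : QOp n)ᴴ =
        (g.2 : QOp n) * ((W : QOp n) * A * (W : QOp n)ᴴ) * (g.2 : QOp n)ᴴ := by
      rw [Submonoid.coe_mul, Matrix.conjTranspose_mul]
      noncomm_ring
    rw [hconj]
    have hmono : s ∪ {i | ∃ g' ∈ gates, i ∈ g'.1 ∧ ¬ Disjoint g'.1 s} ⊆
        s ∪ {i | ∃ g' ∈ g :: gates, i ∈ g'.1 ∧ ¬ Disjoint g'.1 s} := by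
      refine Set.union_subset_union_right s ?_
      rintro i ⟨g', hg', h⟩
      exact ⟨g', List.mem_cons_of_mem _ hg', h⟩
    -- A gate missing `s` also misses the enlarged support, because gates in a layer are disjoint;
    -- it commutes through and cancels with its adjoint. A gate meeting `s` lies inside the claimed
    -- support.
    by_cases h : Disjoint g.1 s
    · have hdis : Disjoint g.1 (s ∪ {i | ∃ g' ∈ gates, i ∈ g'.1 ∧ ¬ Disjoint g'.1 s}) := by
        refine Set.disjoint_union_right.mpr ⟨h, Set.disjoint_left.mpr ?_⟩
        rintro i hi ⟨g', hg', hi', -⟩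
        exact Set.disjoint_left.mp (hd.1 g'.1 (List.mem_map_of_mem hg')) hi hi'
      rw [mul_comm_of_mem_suppSpan hdis hgs ih, mul_assoc _ (g.2 : QOp n),
        show (g.2 : QOp n) * (g.2 : QOp n)ᴴ = 1 from Matrix.mem_unitaryGroup_iff.mp g.2.2, mul_one]
      exact suppSpan_mono hmono ih
    · have hsub : g.1 ⊆ s ∪ {i | ∃ g' ∈ g :: gates, i ∈ g'.1 ∧ ¬ Disjoint g'.1 s} :=
        fun i hi => Or.inr ⟨g, List.mem_cons_self, hi, h⟩
      have hgs' := suppSpan_mono hsub hgs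
      exact mul_mem_suppSpan (mul_mem_suppSpan hgs' (suppSpan_mono hmono ih))
        (conjTranspose_mem_suppSpan hgs')

/-- Two qubits of one gate are at distance at most one, so a gate that meets the ball stays within
one further step. -/
theorem conj_layer_mem_suppSpan {W : QUnitary n} (hW : IsTwoLocalLayer Λ W) {s : Set (Fin n)}
    {L : ℕ} {A : QOp n} (hA : A ∈ suppSpan (Λ.edistBall s L)) :
    (W : QOp n) * A * (W : QOp n)ᴴ ∈ suppSpan (Λ.edistBall s (L + 1)) := by
  obtain ⟨gates, hd, hg, rfl⟩ := hW
  refine suppSpan_mono ?_ (conj_gates_mem_suppSpan gates hd (fun g h => (hg g h).2) hA)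
  rintro i (⟨j, hj, hij⟩ | ⟨g, hgm, hi, hns⟩)
  · exact ⟨j, hj, hij.trans (by exact_mod_cast Nat.le_succ L)⟩
  · obtain ⟨a, b, hab, hs⟩ := (hg g hgm).1
    obtain ⟨k, hk, j, hj, hkj⟩ := Set.not_disjoint_iff.mp hns
    refine ⟨j, hj, ?_⟩
    have hik : Λ.edist i k ≤ 1 := by
      rw [hs] at hi hk
      have h1 : Λ.edist a b ≤ 1 := by
        rcases hab with rfl | hab
        · rw [SimpleGraph.edist_self]; exact zero_le_one
        · exact (SimpleGraph.edist_eq_one_iff_adj.mpr hab).le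
      rcases hi with rfl | rfl <;> rcases hk with rfl | rfl
      · rw [SimpleGraph.edist_self]; exact zero_le_one
      · exact h1
      · rwa [SimpleGraph.edist_comm]
      · rw [SimpleGraph.edist_self]; exact zero_le_one
    calc Λ.edist i j ≤ Λ.edist i k + Λ.edist k j := SimpleGraph.edist_triangle
      _ ≤ 1 + (L : ℕ∞) := add_le_add hik hkj
      _ = ((L + 1 : ℕ) : ℕ∞) := by push_cast; exact add_comm _ _

theorem conj_circuit_mem_suppSpan {L : ℕ} {U : QUnitary n} (hU : IsTwoLocalCircuit Λ L U)
    {s : Set (Fin n)} {A : QOp n} (hA : A ∈ suppSpan s) :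
    (U : QOp n) * A * (U : QOp n)ᴴ ∈ suppSpan (Λ.edistBall s L) := by
  obtain ⟨layers, rfl, hl, rfl⟩ := hU
  induction layers with
  | nil =>
    rw [List.prod_nil, OneMemClass.coe_one, one_mul, Matrix.conjTranspose_one, mul_one]
    exact suppSpan_mono (t := Λ.edistBall s 0)
      (fun i hi => ⟨i, hi, by rw [SimpleGraph.edist_self]; exact zero_le⟩) hA
  | cons W layers ih =>
    have ih := conj_layer_mem_suppSpan (hl W List.mem_cons_self)
      (ih fun W' hW' => hl W' (List.mem_cons_of_mem _ hW'))
    rw [List.length_cons, List.prod_cons, Submonoid.coe_mul, Matrix.conjTranspose_mul]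
    convert ih using 1
    noncomm_ring

end PauliString

/-! ### Lower bounds on the trace norm and the diamond norm -/

theorem Matrix.sum_norm_sq_row_eq_re {ι κ : Type*} [Fintype κ] (A : Matrix ι κ ℂ) (i : ι) :
    ∑ k, ‖A i k‖ ^ 2 = ((A * Aᴴ) i i).re := by
  rw [Matrix.mul_apply, Complex.re_sum]
  refine Finset.sum_congr rfl fun k _ => ?_
  rw [Matrix.conjTranspose_apply, Complex.star_def, Complex.mul_conj', ← Complex.ofReal_pow,
    Complex.ofReal_re]

/-- In an eigenbasis `V` of `DᴴD` the trace pairs the rows of `VᴴM`, which are unit vectors, with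
the columns of `DV`, whose norms are the singular values of `D`. Cauchy–Schwarz is applied to each
pair. -/
theorem norm_trace_mul_le_traceNorm {ι : Type*} [Fintype ι] [DecidableEq ι] {M : Matrix ι ι ℂ}
    (hM : M * Mᴴ = 1) (D : Matrix ι ι ℂ) : ‖(M * D).trace‖ ≤ traceNorm D := by
  set hD := Matrix.isHermitian_conjTranspose_mul_self D
  set V : Matrix ι ι ℂ := (hD.eigenvectorUnitary : Matrix ι ι ℂ)
  have hV : V * Vᴴ = 1 := Matrix.mem_unitaryGroup_iff.mp hD.eigenvectorUnitary.2
  have hV' : Vᴴ * V = 1 := Matrix.mem_unitaryGroup_iff'.mp hD.eigenvectorUnitary.2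
  have hspec : Vᴴ * (Dᴴ * D) * V = Matrix.diagonal fun i => (hD.eigenvalues i : ℂ) := by
    have h := hD.spectral_theorem
    rw [Unitary.conjStarAlgAut_apply] at h
    change Dᴴ * D = V * Matrix.diagonal (fun i => (hD.eigenvalues i : ℂ)) * Vᴴ at h
    refine (congrArg (fun X => Vᴴ * X * V) h).trans ?_
    rw [show ∀ X : Matrix ι ι ℂ, Vᴴ * (V * X * Vᴴ) * V = (Vᴴ * V) * X * (Vᴴ * V) by
      intro X; noncomm_ring, hV', one_mul, mul_one]
  have htr : (M * D).trace = ∑ i, ∑ k, (Vᴴ * M) i k * (D * V) k i := by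
    rw [show (M * D).trace = ((Vᴴ * M) * (D * V)).trace by
      rw [Matrix.trace_mul_comm (Vᴴ * M), show D * V * (Vᴴ * M) = D * (V * Vᴴ) * M by noncomm_ring,
        hV, mul_one, Matrix.trace_mul_comm]]
    rfl
  have hrow : ∀ i, ∑ k, ‖(Vᴴ * M) i k‖ ^ 2 = 1 := by
    intro i
    rw [Matrix.sum_norm_sq_row_eq_re, Matrix.conjTranspose_mul, Matrix.conjTranspose_conjTranspose,
      show Vᴴ * M * (Mᴴ * V) = Vᴴ * (M * Mᴴ) * V by noncomm_ring, hM, mul_one, hV']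
    simp
  have hcol : ∀ i, ∑ k, ‖(D * V) k i‖ ^ 2 = hD.eigenvalues i := by
    intro i
    have h : ∑ k, ‖(D * V) k i‖ ^ 2 = ∑ k, ‖(D * V)ᴴ i k‖ ^ 2 := by
      simp only [Matrix.conjTranspose_apply, norm_star]
    rw [h, Matrix.sum_norm_sq_row_eq_re, Matrix.conjTranspose_conjTranspose,
      Matrix.conjTranspose_mul, show Vᴴ * Dᴴ * (D * V) = Vᴴ * (Dᴴ * D) * V by noncomm_ring, hspec]
    simp
  rw [htr, traceNorm]
  refine (norm_sum_le _ _).trans (Finset.sum_le_sum fun i _ => ?_)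
  calc ‖∑ k, (Vᴴ * M) i k * (D * V) k i‖
      ≤ ∑ k, ‖(Vᴴ * M) i k‖ * ‖(D * V) k i‖ :=
        (norm_sum_le _ _).trans (Finset.sum_le_sum fun k _ => (norm_mul _ _).le)
    _ ≤ Real.sqrt (∑ k, ‖(Vᴴ * M) i k‖ ^ 2) * Real.sqrt (∑ k, ‖(D * V) k i‖ ^ 2) :=
        Real.sum_mul_le_sqrt_mul_sqrt _ _ _
    _ = Real.sqrt (hD.eigenvalues i) := by rw [hrow, hcol, Real.sqrt_one, one_mul]

theorem le_diamondNorm {ι : Type*} [Fintype ι] [DecidableEq ι]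
    (Φ : Matrix ι ι ℂ → Matrix ι ι ℂ) {ρ : Matrix ι ι ℂ} (hρ : ρ.PosSemidef) (htr : ρ.trace = 1)
    {M : Matrix ι ι ℂ} (hM : M * Mᴴ = 1) :
    ENNReal.ofReal ‖(M * Φ ρ).trace‖ ≤ diamondNorm Φ := by
  let e : ι × Fin 1 ≃ ι := Equiv.prodUnique ι (Fin 1)
  have htrace : ∀ A : Matrix ι ι ℂ, (A.submatrix e e).trace = A.trace := fun A =>
    Fintype.sum_equiv e _ _ fun _ => rfl
  have hM' : M.submatrix e e * (M.submatrix e e)ᴴ = 1 := by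
    rw [Matrix.conjTranspose_submatrix, Matrix.submatrix_mul_equiv, hM, Matrix.submatrix_one_equiv]
  have hle := norm_trace_mul_le_traceNorm hM' ((Φ ρ).submatrix e e)
  rw [Matrix.submatrix_mul_equiv, htrace] at hle
  refine (ENNReal.ofReal_le_ofReal hle).trans ?_
  refine le_iSup_of_le 1 (le_iSup_of_le (ρ.submatrix e e)
    (le_iSup_of_le ⟨hρ.submatrix e, (htrace ρ).trans htr⟩ ?_))
  -- With a one-point ancilla, `ampliate Φ` of the reindexed state unfolds to the reindexed `Φ ρ`.
  exact le_rfl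

/-! ### Moments and Haar averages -/

/-- Compactness makes continuous functions on the unitary group bounded, hence integrable for every
finite Borel measure. -/
instance instCompactSpaceQUnitary (n : ℕ) : CompactSpace (QUnitary n) := by
  refine isCompact_iff_compactSpace.mp ?_
  refine IsCompact.of_isClosed_subset (X := QOp n) (isCompact_univ_pi fun _ : QBasis n =>
    isCompact_univ_pi fun _ : QBasis n => isCompact_closedBall (0 : ℂ) 1) ?_ ?_
  · have : ((Matrix.unitaryGroup (QBasis n) ℂ : Submonoid (QOp n)) : Set (QOp n)) =
        {A | A * Aᴴ = 1} := by
      ext A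
      exact Matrix.mem_unitaryGroup_iff
    rw [this]
    exact isClosed_eq (by fun_prop) continuous_const
  · intro A hA i _ j _
    rw [mem_closedBall_zero_iff]
    exact entry_norm_bound_of_unitary hA i j

open MeasureTheory in
theorem trace_mul_secondMoment {n : ℕ} (ν : Measure (QUnitary n)) [IsFiniteMeasure ν]
    (M X : QOp2 n) : (M * secondMoment ν X).trace = ∫ U : QUnitary n,
      (M * (((U : QOp n) ⊗ₖ (U : QOp n)) * X * ((U : QOp n) ⊗ₖ (U : QOp n))ᴴ)).trace ∂ν := by
  let g : QBasis n × QBasis n → QBasis n × QBasis n → QUnitary n → ℂ := fun i j U =>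
    (((U : QOp n) ⊗ₖ (U : QOp n)) * X * ((U : QOp n) ⊗ₖ (U : QOp n))ᴴ) i j
  have hint : ∀ i j, Integrable (g i j) ν := by
    intro i j
    refine Continuous.integrable_of_hasCompactSupport ?_ (HasCompactSupport.of_compactSpace _)
    have h1 : Continuous fun U : QUnitary n => (U : QOp n) ⊗ₖ (U : QOp n) := by
      refine continuous_matrix fun a b => ?_
      simp only [Matrix.kroneckerMap_apply]
      exact (continuous_subtype_val.matrix_elem _ _).mul (continuous_subtype_val.matrix_elem _ _)
    exact ((h1.matrix_mul continuous_const).matrix_mul h1.matrix_conjTranspose).matrix_elem i j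
  simp only [Matrix.trace, Matrix.diag, Matrix.mul_apply (M := M)]
  change ∑ i, ∑ j, M i j * ∫ U, g j i U ∂ν = ∫ U, ∑ i, ∑ j, M i j * g j i U ∂ν
  rw [integral_finsetSum (f := fun i U => ∑ j, M i j * g j i U) _
    fun i _ => integrable_finsetSum _ fun j _ => (hint j i).const_mul _]
  refine Finset.sum_congr rfl fun i _ => ?_
  rw [integral_finsetSum (f := fun j U => M i j * g j i U) _ fun j _ => (hint j i).const_mul _]
  exact Finset.sum_congr rfl fun j _ => (integral_const_mul _ _).symm

open PauliString in
theorem PauliString.continuous_coeff_conj {n : ℕ} (P Q : PauliString n) :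
    Continuous fun U : QUnitary n => ‖coeff Q ((U : QOp n) * P.op * (U : QOp n)ᴴ)‖ ^ 2 := by
  unfold coeff
  have h : Continuous fun U : QUnitary n => (U : QOp n) := continuous_subtype_val
  exact (((continuous_const.matrix_mul ((h.matrix_mul continuous_const).matrix_mul
    h.matrix_conjTranspose)).matrix_trace).div_const _).norm.pow 2

/-! ### Haar averages of squared Pauli coefficients -/

namespace IsPauliCompatible

open MeasureTheory PauliString

variable {n : ℕ} {G : Subgroup (QUnitary n)} {S : Set (PauliString n)}

/-- Adjacent Pauli strings are related, up to a phase, by conjugation in the group. -/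
theorem exists_norm_coeff_conj_eq (hG : IsPauliCompatible G S) {Q R : PauliString n}
    (h : (commutatorGraph S).Adj Q R) : ∃ V ∈ G, ∀ A : QOp n,
      ‖coeff Q ((V : QOp n)ᴴ * A * (V : QOp n))‖ = ‖coeff R A‖ := by
  obtain ⟨H, hH, hc⟩ := h
  obtain ⟨hanti, c, -, hc⟩ := hc.spec
  -- Both `H Q` and `R` are unitary, so the scalar between them is a phase.
  have hnorm : ‖c‖ = 1 := by
    have h1 : (H.op * Q.op)ᴴ * (H.op * Q.op) = 1 := by
      rw [Matrix.conjTranspose_mul, conjTranspose_op, conjTranspose_op,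
        show Q.op * H.op * (H.op * Q.op) = Q.op * (H.op * H.op) * Q.op by noncomm_ring,
        op_mul_self, mul_one, op_mul_self]
    rw [hc, Matrix.conjTranspose_smul, conjTranspose_op, smul_mul_smul_comm, op_mul_self,
      Complex.star_def, Complex.conj_mul'] at h1
    have h2 := congrFun (congrFun h1 0) 0
    rw [Matrix.smul_apply, Matrix.one_apply_eq, smul_eq_mul, mul_one] at h2
    have h3 : ‖c‖ ^ 2 = 1 := by exact_mod_cast h2
    exact (pow_eq_one_iff_of_nonneg (norm_nonneg c) two_ne_zero).mp h3
  obtain ⟨V, hV, hVe⟩ := hG.rot_mem hH (Real.pi / 4)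
  refine ⟨V, hV, fun A => ?_⟩
  have hconj : (V : QOp n) * Q.op * (V : QOp n)ᴴ = (Complex.I * c) • R.op := by
    rw [hVe, rot_conj_of_anticomm hanti, hc, smul_smul]
    have : (2 * ((Real.pi / 4 : ℝ) : ℂ)) = ((Real.pi / 2 : ℝ) : ℂ) := by push_cast; ring
    rw [this, ← Complex.ofReal_cos, ← Complex.ofReal_sin, Real.cos_pi_div_two,
      Real.sin_pi_div_two, Complex.ofReal_zero, zero_smul, zero_add, Complex.ofReal_one, one_mul]
  have : (Q.op * ((V : QOp n)ᴴ * A * (V : QOp n))).trace = Complex.I * c * (R.op * A).trace := by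
    rw [show Q.op * ((V : QOp n)ᴴ * A * (V : QOp n)) = (Q.op * (V : QOp n)ᴴ * A) * (V : QOp n) by
      noncomm_ring, Matrix.trace_mul_comm, show (V : QOp n) * (Q.op * (V : QOp n)ᴴ * A) =
      (V : QOp n) * Q.op * (V : QOp n)ᴴ * A by noncomm_ring, hconj, smul_mul_assoc,
      Matrix.trace_smul, smul_eq_mul]
  rw [coeff, coeff, this, mul_div_assoc, norm_mul, norm_mul, hnorm, Complex.norm_I, one_mul,
    one_mul]

/-- Along an edge, the substitution `U ↦ V⁻¹ U` exchanges the two coefficients up to a phase and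
preserves the measure. -/
theorem integral_coeff_sq_eq_of_reachable (hG : IsPauliCompatible G S) (μ : Measure G)
    [μ.IsMulLeftInvariant] (P : PauliString n) {Q R : PauliString n}
    (h : (commutatorGraph S).Reachable Q R) :
    ∫ U : G, ‖coeff Q (((U : QUnitary n) : QOp n) * P.op * ((U : QUnitary n) : QOp n)ᴴ)‖ ^ 2 ∂μ =
      ∫ U : G, ‖coeff R (((U : QUnitary n) : QOp n) * P.op *
        ((U : QUnitary n) : QOp n)ᴴ)‖ ^ 2 ∂μ := by
  obtain ⟨w⟩ := h
  induction w with
  | nil => rfl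
  | cons hadj _ ih =>
    rw [← ih]
    obtain ⟨V, hV, hVe⟩ := hG.exists_norm_coeff_conj_eq hadj
    rw [← integral_mul_left_eq_self _ (⟨V, hV⟩⁻¹ : G)]
    refine integral_congr_ae (Filter.Eventually.of_forall fun U => ?_)
    dsimp only
    rw [← hVe]
    congr 3
    change ((V : QOp n)ᴴ * ((U : QUnitary n) : QOp n)) * P.op *
      ((V : QOp n)ᴴ * ((U : QUnitary n) : QOp n))ᴴ = _
    rw [Matrix.conjTranspose_mul, Matrix.conjTranspose_conjTranspose]
    noncomm_ring

/-- The squared Pauli coefficients of `U P U†` in a set of strings that contains all those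
that can occur sum to one. -/
theorem _root_.PauliString.sum_norm_coeff_conj_sq (U : QUnitary n) (P : PauliString n)
    (F : Finset (PauliString n))
    (hF : ∀ Q ∉ F, coeff Q ((U : QOp n) * P.op * (U : QOp n)ᴴ) = 0) :
    ∑ Q ∈ F, ‖coeff Q ((U : QOp n) * P.op * (U : QOp n)ᴴ)‖ ^ 2 = 1 := by
  have hU : (U : QOp n)ᴴ * U = 1 := Matrix.mem_unitaryGroup_iff'.mp U.2
  have hU' : (U : QOp n) * (U : QOp n)ᴴ = 1 := Matrix.mem_unitaryGroup_iff.mp U.2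
  have h := sum_norm_coeff_sq ((U : QOp n) * P.op * (U : QOp n)ᴴ)
  rw [Matrix.conjTranspose_mul, Matrix.conjTranspose_mul, Matrix.conjTranspose_conjTranspose,
    conjTranspose_op, show (U : QOp n) * (P.op * (U : QOp n)ᴴ) * (U * P.op * (U : QOp n)ᴴ) =
      U * (P.op * ((U : QOp n)ᴴ * U) * P.op) * (U : QOp n)ᴴ by noncomm_ring, hU, mul_one,
    op_mul_self, mul_one, hU', ← P.op_mul_self, trace_op_mul, if_pos rfl,
    div_self (pow_ne_zero n two_ne_zero)] at h
  rw [Finset.sum_subset (Finset.subset_univ F) fun Q _ hQ => by rw [hF Q hQ]; simp]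
  exact_mod_cast h

theorem _root_.PauliString.integrable_coeff_sq (μ : Measure G) [IsFiniteMeasure μ]
    (P Q : PauliString n) : Integrable (fun U : G => ‖coeff Q (((U : QUnitary n) : QOp n) *
      P.op * ((U : QUnitary n) : QOp n)ᴴ)‖ ^ 2) μ := by
  have hc := P.continuous_coeff_conj Q
  obtain ⟨b, hb⟩ := isCompact_univ.exists_bound_of_continuousOn hc.continuousOn
  exact Integrable.of_bound (hc.comp continuous_subtype_val).measurable.aestronglyMeasurable b
    (Filter.Eventually.of_forall fun U => hb U (Set.mem_univ _))

/-- By Parseval the averages over the component sum to one, and connectedness makes them equal. -/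
theorem integral_coeff_sq (hG : IsPauliCompatible G S) (μ : Measure G)
    [μ.IsMulLeftInvariant] [IsProbabilityMeasure μ] (P : PauliString n) {Q : PauliString n}
    (hQ : Q ∈ commutatorComponent S P) :
    ∫ U : G, ‖coeff Q (((U : QUnitary n) : QOp n) * P.op * ((U : QUnitary n) : QOp n)ᴴ)‖ ^ 2 ∂μ =
      1 / ((commutatorComponent S P).ncard : ℝ) := by
  classical
  have hsum : ∑ R ∈ (commutatorComponent S P).toFinset, ∫ U : G, ‖coeff R
      (((U : QUnitary n) : QOp n) * P.op * ((U : QUnitary n) : QOp n)ᴴ)‖ ^ 2 ∂μ = 1 := by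
    rw [← integral_finsetSum _ fun R _ => integrable_coeff_sq μ P R]
    rw [integral_congr_ae (g := fun _ => (1 : ℝ)) (Filter.Eventually.of_forall fun U => ?_)]
    · simp
    · refine sum_norm_coeff_conj_sq (U : QUnitary n) P _ fun R hR => ?_
      exact coeff_eq_zero_of_mem_span (by simpa using hR) (hG.conj_mem_span U.2 P)
  have hreach : ∀ R ∈ (commutatorComponent S P).toFinset, (commutatorGraph S).Reachable R Q := by
    intro R hR
    have hPR : R ∈ commutatorComponent S P := Set.mem_toFinset.mp hR
    exact SimpleGraph.Reachable.trans (SimpleGraph.Reachable.symm hPR) hQ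
  rw [Finset.sum_congr rfl fun R hR => hG.integral_coeff_sq_eq_of_reachable μ P (hreach R hR),
    Finset.sum_const, nsmul_eq_mul, ← Set.ncard_eq_toFinset_card'] at hsum
  exact eq_one_div_of_mul_eq_one_right hsum

end IsPauliCompatible

/-! ### The test state and the test measurement -/

theorem Matrix.star_entries_dotProduct_entries {ι κ : Type*} [Fintype ι] [Fintype κ]
    (A B : Matrix ι κ ℂ) :
    star (fun x : ι × κ => A x.1 x.2) ⬝ᵥ (fun x => B x.1 x.2) = (Aᴴ * B).trace := by
  rw [dotProduct, Fintype.sum_prod_type, Finset.sum_comm]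
  rfl

namespace PauliString

variable {n : ℕ}

/-- The vector on two copies with the entries of `A K`. -/
noncomputable def pairVec (K : PauliString n) (A : QOp n) : QBasis n × QBasis n → ℂ :=
  fun x => (A * K.op) x.1 x.2

theorem pairVec_def (K : PauliString n) (A : QOp n) :
    K.pairVec A = fun x => (A * K.op) x.1 x.2 := rfl

/-- Since `K` squares to `1` it drops out, so overlaps with the test vectors read off Pauli
coefficients. -/
theorem star_pairVec_dotProduct (K Q : PauliString n) (A : QOp n) :
    star (K.pairVec Q.op) ⬝ᵥ K.pairVec A = 2 ^ n * coeff Q A := by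
  rw [pairVec_def, pairVec_def, Matrix.star_entries_dotProduct_entries, Matrix.conjTranspose_mul,
    conjTranspose_op, conjTranspose_op, show K.op * Q.op * (A * K.op) = (K.op * Q.op * A) * K.op by
      noncomm_ring, Matrix.trace_mul_comm, show K.op * (K.op * Q.op * A) =
      K.op * K.op * (Q.op * A) by noncomm_ring, op_mul_self, one_mul, coeff,
    mul_div_cancel₀ _ (pow_ne_zero n two_ne_zero)]

/-- The pure state with vector `(Q ⊗ 1) |Ψ⟩`, where `|Ψ⟩` has the entries of `K`. -/
noncomputable def state (K Q : PauliString n) : QOp2 n :=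
  ((2 : ℂ) ^ n)⁻¹ • Matrix.vecMulVec (K.pairVec Q.op) (star (K.pairVec Q.op))

theorem two_pow_inv_nonneg (n : ℕ) : (0 : ℂ) ≤ ((2 : ℂ) ^ n)⁻¹ := by
  rw [show ((2 : ℂ) ^ n)⁻¹ = (((2 : ℝ) ^ n)⁻¹ : ℝ) by push_cast; rfl]
  exact Complex.zero_le_real.mpr (by positivity)

theorem posSemidef_state (K Q : PauliString n) : (K.state Q).PosSemidef :=
  (Matrix.posSemidef_vecMulVec_self_star _).smul (two_pow_inv_nonneg n)

theorem trace_state (K Q : PauliString n) : (K.state Q).trace = 1 := by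
  rw [state, Matrix.trace_smul, Matrix.trace_vecMulVec, dotProduct_comm, star_pairVec_dotProduct,
    coeff_op, if_pos rfl, mul_one, smul_eq_mul, inv_mul_cancel₀ (pow_ne_zero n two_ne_zero)]

theorem state_mul_state (K Q R : PauliString n) :
    K.state Q * K.state R = if Q = R then K.state Q else 0 := by
  rw [state, state, smul_mul_smul_comm, Matrix.vecMulVec_mul_vecMulVec, star_pairVec_dotProduct,
    coeff_op]
  split_ifs with h
  · subst h
    rw [mul_one, Matrix.vecMulVec_smul, smul_smul, mul_assoc,
      inv_mul_cancel₀ (pow_ne_zero n two_ne_zero), mul_one]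
  · rw [mul_zero, zero_smul, Matrix.vecMulVec_zero, smul_zero]

/-- The reflection that is `1` on the span of the vectors `(Q ⊗ 1) |Ψ⟩` with `Q ∈ F`, and `-1`
on its orthogonal complement. -/
noncomputable def reflection (K : PauliString n) (F : Finset (PauliString n)) : QOp2 n :=
  (2 : ℂ) • ∑ Q ∈ F, K.state Q - 1

theorem reflection_mul_conjTranspose (K : PauliString n) (F : Finset (PauliString n)) :
    K.reflection F * (K.reflection F)ᴴ = 1 := by
  have hsq : (∑ Q ∈ F, K.state Q) * (∑ Q ∈ F, K.state Q) = ∑ Q ∈ F, K.state Q := by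
    rw [Finset.sum_mul]
    refine Finset.sum_congr rfl fun Q hQ => ?_
    rw [Finset.mul_sum, Finset.sum_congr rfl fun R _ => K.state_mul_state Q R, Finset.sum_ite_eq,
      if_pos hQ]
  have hH : (∑ Q ∈ F, K.state Q)ᴴ = ∑ Q ∈ F, K.state Q := by
    rw [Matrix.conjTranspose_sum]
    exact Finset.sum_congr rfl fun Q _ => (K.posSemidef_state Q).isHermitian
  rw [reflection, Matrix.conjTranspose_sub, Matrix.conjTranspose_smul, hH, Matrix.conjTranspose_one,
    Complex.star_def, map_ofNat, sub_mul, mul_sub, smul_mul_smul_comm, hsq, one_mul, mul_one]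
  module

/-- The expectation value of the reflection in the rotated test state. -/
theorem trace_reflection_mul_conj {K : PauliString n} {U : QUnitary n}
    (hK : (U : QOp n) * K.op * (U : QOp n)ᵀ = K.op) (P : PauliString n)
    (F : Finset (PauliString n)) :
    (K.reflection F * (((U : QOp n) ⊗ₖ (U : QOp n)) * K.state P *
      ((U : QOp n) ⊗ₖ (U : QOp n))ᴴ)).trace =
      ((2 * ∑ Q ∈ F, ‖coeff Q ((U : QOp n) * P.op * (U : QOp n)ᴴ)‖ ^ 2 - 1 : ℝ) : ℂ) := by
  set A : QOp n := (U : QOp n) * P.op * (U : QOp n)ᴴ with hA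
  have hU : (U : QOp n)ᴴ * U = 1 := Matrix.mem_unitaryGroup_iff'.mp U.2
  -- Replacing `K` by `U K Uᵀ` in `U P Uᴴ K` and cancelling `UᴴU` leaves `U P K Uᵀ`.
  have hvec : ((U : QOp n) ⊗ₖ (U : QOp n)) *ᵥ K.pairVec P.op = K.pairVec A := by
    rw [pairVec_def, Matrix.kronecker_mulVec_entries, pairVec_def, hA]
    rw [show (U : QOp n) * P.op * (U : QOp n)ᴴ * K.op = U * P.op * (U : QOp n)ᴴ *
      (U * K.op * (U : QOp n)ᵀ) by rw [hK], show (U : QOp n) * P.op * (U : QOp n)ᴴ *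
      (U * K.op * (U : QOp n)ᵀ) = U * P.op * ((U : QOp n)ᴴ * U) * K.op * (U : QOp n)ᵀ by
      noncomm_ring, hU, mul_one, ← mul_assoc]
  have hrot : ((U : QOp n) ⊗ₖ (U : QOp n)) * K.state P * ((U : QOp n) ⊗ₖ (U : QOp n))ᴴ =
      ((2 : ℂ) ^ n)⁻¹ • Matrix.vecMulVec (K.pairVec A) (star (K.pairVec A)) := by
    rw [state, mul_smul_comm, smul_mul_assoc, Matrix.mul_vecMulVec, Matrix.vecMulVec_mul,
      ← Matrix.star_mulVec, hvec]
  have htr : (((U : QOp n) ⊗ₖ (U : QOp n)) * K.state P *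
      ((U : QOp n) ⊗ₖ (U : QOp n))ᴴ).trace = 1 := by
    rw [Matrix.trace_mul_comm, ← mul_assoc, Matrix.conjTranspose_kronecker,
      ← Matrix.mul_kronecker_mul, hU, Matrix.one_kronecker_one, one_mul, trace_state]
  have hproj : ∀ Q : PauliString n, (K.state Q * (((2 : ℂ) ^ n)⁻¹ •
      Matrix.vecMulVec (K.pairVec A) (star (K.pairVec A)))).trace = ((‖coeff Q A‖ ^ 2 : ℝ) : ℂ) := by
    intro Q
    have h2 : ((2 : ℂ) ^ n) ≠ 0 := pow_ne_zero n two_ne_zero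
    have hstar : star (K.pairVec A) ⬝ᵥ K.pairVec Q.op = 2 ^ n * star (coeff Q A) := by
      rw [Matrix.star_dotProduct, star_pairVec_dotProduct]
      simp
    rw [state, smul_mul_smul_comm, Matrix.vecMulVec_mul_vecMulVec, star_pairVec_dotProduct,
      Matrix.trace_smul, Matrix.trace_vecMulVec, dotProduct_smul, dotProduct_comm, hstar]
    push_cast
    rw [← Complex.mul_conj', smul_eq_mul, smul_eq_mul, Complex.star_def]
    field_simp
  rw [reflection, sub_mul, one_mul, Matrix.trace_sub, htr, hrot, smul_mul_assoc, Matrix.trace_smul,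
    Finset.sum_mul, Matrix.trace_sum, Finset.sum_congr rfl fun Q _ => hproj Q, smul_eq_mul]
  push_cast
  rfl

end PauliString

open MeasureTheory PauliString in
theorem corollary6 (n : ℕ) (Λ : SimpleGraph (Fin n))
    (G : Subgroup (QUnitary n)) (hGc : IsCompact (G : Set (QUnitary n)))
    (S : Set (PauliString n)) (hG : IsPauliCompatible G S) (hinv : HasInvariantState G)
    (μ : MeasureTheory.Measure G) [μ.IsHaarMeasure] [MeasureTheory.IsProbabilityMeasure μ]
    (L : ℕ)
    (ν : MeasureTheory.Measure (QUnitary n)) [MeasureTheory.IsProbabilityMeasure ν]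
    (hν : ∀ᵐ U ∂ν, U ∈ G ∧ IsTwoLocalCircuit Λ L U)
    (P : PauliString n) :
    ENNReal.ofReal (2 * (1 - lightconeFraction Λ S P L)) ≤
      diamondNorm fun X =>
        secondMoment ν X - secondMoment (μ.map (fun U : G => (U : QUnitary n))) X := by
  classical
  obtain ⟨K, hK⟩ := hG.exists_invariant_op hinv
  set T : Set (PauliString n) := {Q ∈ commutatorComponent S P |
    ∀ i ∈ Q.support, ∃ j ∈ P.support, Λ.edist i j ≤ (L : ℕ∞)} with hT
  have hcoe : MeasurableEmbedding fun U : G => (U : QUnitary n) :=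
    MeasurableEmbedding.subtype_coe hGc.isClosed.measurableSet
  -- Almost every circuit gives weight `1` on `T`, so the integrand is `2 · 1 - 1`.
  have hν' : (K.reflection T.toFinset * secondMoment ν (K.state P)).trace = 1 := by
    rw [trace_mul_secondMoment, integral_congr_ae (g := fun _ => (1 : ℂ))]
    · simp
    · filter_upwards [hν] with U ⟨hU, hc⟩
      rw [trace_reflection_mul_conj (hK U hU), sum_norm_coeff_conj_sq]
      · norm_num
      · intro Q hQ
        by_cases hQC : Q ∈ commutatorComponent S P
        · refine coeff_eq_zero_of_mem_span (fun hQL => hQ ?_)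
            (conj_circuit_mem_suppSpan hc (op_mem_suppSpan (Set.Subset.refl P.support)))
          exact Set.mem_toFinset.mpr ⟨hQC, hQL⟩
        · exact coeff_eq_zero_of_mem_span hQC (hG.conj_mem_span hU P)
  -- Each of the strings in `T` has average weight `1 / |C|`, which gives `|T| / |C|` in total.
  have hμ' : (K.reflection T.toFinset *
      secondMoment (μ.map (fun U : G => (U : QUnitary n))) (K.state P)).trace =
      ((2 * lightconeFraction Λ S P L - 1 : ℝ) : ℂ) := by
    have := Measure.isProbabilityMeasure_map (μ := μ) hcoe.measurable.aemeasurable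
    rw [trace_mul_secondMoment, hcoe.integral_map]
    rw [integral_congr_ae (Filter.Eventually.of_forall fun U : G =>
      trace_reflection_mul_conj (hK U U.2) P T.toFinset), integral_complex_ofReal,
      integral_sub ((integrable_finsetSum _ fun Q _ => integrable_coeff_sq μ P Q).const_mul 2) (integrable_const _),
      integral_const_mul, integral_finsetSum _ fun Q _ => integrable_coeff_sq μ P Q,
      Finset.sum_congr rfl fun Q hQ => hG.integral_coeff_sq μ P (Set.mem_toFinset.mp hQ).1]
    rw [Finset.sum_const, nsmul_eq_mul, ← Set.ncard_eq_toFinset_card', lightconeFraction]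
    simp [div_eq_mul_inv, hT]
  refine le_trans (ENNReal.ofReal_le_ofReal ?_) (le_diamondNorm _ (K.posSemidef_state P)
    (K.trace_state P) (K.reflection_mul_conjTranspose T.toFinset))
  -- The expectations differ by `1 - (2r - 1) = 2(1 - r)`.
  rw [Matrix.mul_sub, Matrix.trace_sub, hν', hμ', ← Complex.ofReal_one, ← Complex.ofReal_sub,
    Complex.norm_real]
  refine le_trans (le_of_eq ?_) (le_abs_self _)
  ring
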